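/- For $n \ge 1$ let $e_1,\dots,e_n$ be the standard basis of $\mathbb{R}^n$, let $B^n$ be the closed Euclidean unit ball, $\square^n=[-1,1]^n$ the cube, and $L_n=\{e_1,-e_1,\dots,e_n,-e_n\}$ the set of octahedral labels (the extreme points of the octahedron $\{x : \|x\|_1\le 1\}$). A triangulation $T$ of a set $X\subseteq\mathbb{R}^n$ is a finite family of geometric simplices with union $X$ that contains every face of each of its simplices and in which any two simplices meet in a (possibly empty) common face; $V(T)$ is its set of vertices. Given $\lambda:V(T)\to L_n$, we say that $T$ contains a complementary edge if some simplex of $T$ has two vertices $v,w$ with $\lambda(v)=-\lambda(w)$. Consider the following two statements. **Tucker's lemma in dimension $n$.** Let $X\subseteq\mathbb{R}^n$ be homeomorphic to $B^n$, and let $T$ be a triangulation of $X$ such that for every simplex $\sigma\in T$ contained in the boundary $\partial X$ the reflected simplex $-\sigma$ is also a simplex of $T$ contained in $\partial X$. Let $\lambda:V(T)\to L_n$ satisfy $\lambda(v)=-\lambda(-v)$ for all $v\in V(T)\cap\partial X$. Then $T$ contains a complementary edge. **Cubical Sperner theorem with octahedral labels in dimension $n$.** Let $T$ be a triangulation of $\square^n$,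 and let $\lambda:V(T)\to L_n$ be such that for every vertex $x=(x_1,\dots,x_n)\in V(T)$ and every $1\le i\le n$ with $x_i\in\{-1,1\}$ we have $\lambda(x)\ne -x_ie_i$. Then $T$ contains a complementary edge. **Theorem.** For every $n\ge 1$, Tucker's lemma in dimension $n$ implies the cubical Sperner theorem with octahedral labels in dimension $n$. -/

import Mathlib

/-- `ℝⁿ`. -/
abbrev Rn (n : ℕ) : Type := EuclideanSpace ℝ (Fin n)

/-- `K` is a (finite, geometric) triangulation of the set `X ⊆ ℝⁿ`. -/
def IsTriangulation {n : ℕ} (K : Geometry.SimplicialComplex ℝ (Rn n)) (X : Set (Rn n)) : Prop :=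
  K.faces.Finite ∧ K.space = X

/-- `X` is homeomorphic to the closed Euclidean unit ball `Bⁿ`. -/
def IsTopologicalBall {n : ℕ} (X : Set (Rn n)) : Prop :=
  Nonempty (X ≃ₜ Metric.closedBall (0 : Rn n) 1)

/-- The cube `[-1, 1]ⁿ`. -/
def cube (n : ℕ) : Set (Rn n) :=
  {x | ∀ i, |x i| ≤ 1}

/-- The octahedral labels `{e₁, -e₁, …, eₙ, -eₙ}`, i.e. the extreme points of the `n`-dimensional
octahedron. -/
def octahedralLabels (n : ℕ) : Set (Rn n) :=
  {v | ∃ i : Fin n, v = EuclideanSpace.single i 1 ∨ v = -EuclideanSpace.single i 1}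

/-- `lab` labels the vertices of `K` by octahedral labels; its values at points that are not
vertices of `K` are irrelevant. -/
def IsOctahedralLabelling {n : ℕ} (K : Geometry.SimplicialComplex ℝ (Rn n))
    (lab : Rn n → Rn n) : Prop :=
  ∀ v ∈ K.vertices, lab v ∈ octahedralLabels n

/-- Some simplex of `K` has two vertices with opposite labels. -/
def HasComplementaryEdge {n : ℕ} (K : Geometry.SimplicialComplex ℝ (Rn n))
    (lab : Rn n → Rn n) : Prop :=
  ∃ s ∈ K.faces, ∃ v ∈ s, ∃ w ∈ s, lab v = -lab w

/-- The simplices of `K` (given by their vertex sets) that lie entirely in the topological boundary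
of the underlying set of `K`. -/
def boundaryFaces {n : ℕ} (K : Geometry.SimplicialComplex ℝ (Rn n)) : Set (Finset (Rn n)) :=
  {s | s ∈ K.faces ∧ convexHull ℝ (s : Set (Rn n)) ⊆ frontier K.space}

/-- The reflected simplex `-s` of every boundary simplex `s` is again a boundary simplex. -/
def IsAntipodallySymmetricOnBoundary {n : ℕ} (K : Geometry.SimplicialComplex ℝ (Rn n)) : Prop :=
  ∀ s ∈ boundaryFaces K, s.map (Equiv.neg (Rn n)).toEmbedding ∈ boundaryFaces K

/-- Tucker's lemma in dimension `n`. -/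
def TuckerLemma (n : ℕ) : Prop :=
  ∀ (X : Set (Rn n)) (K : Geometry.SimplicialComplex ℝ (Rn n)) (lab : Rn n → Rn n),
    IsTopologicalBall X →
    IsTriangulation K X →
    IsAntipodallySymmetricOnBoundary K →
    IsOctahedralLabelling K lab →
    (∀ v ∈ K.vertices, v ∈ frontier X → lab v = -lab (-v)) →
    HasComplementaryEdge K lab

/-- The cubical Sperner theorem with octahedral labels in dimension `n`. -/
def CubicalSpernerOctahedralLabels (n : ℕ) : Prop :=
  ∀ (K : Geometry.SimplicialComplex ℝ (Rn n)) (lab : Rn n → Rn n),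
    IsTriangulation K (cube n) →
    IsOctahedralLabelling K lab →
    (∀ x ∈ K.vertices, ∀ i : Fin n, (x i = -1 ∨ x i = 1) →
      lab x ≠ -(x i • EuclideanSpace.single i (1 : ℝ))) →
    HasComplementaryEdge K lab

/-! Put the cube inside the octahedron of radius `n + 1` and extend the triangulation outwards: a
simplex lying in the cube face where `x i = ε i` for all `i` with `ε i ≠ 0` is joined with the
apexes `(n + 1) ε i eᵢ` of the dual octahedron face. Label each apex `± (n + 1) eᵢ` by `± eᵢ`. The
cube is interior, so boundary simplices consist of apexes only, and both symmetry hypotheses of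
Tucker's lemma hold. The resulting complementary edge uses no apex: a simplex has at most one apex
per axis, and the Sperner condition forbids the label `-ε i eᵢ` at its cube vertices
(`hasComplementaryEdge_of_octahedralExtension`). The geometric work is that the joins form a
triangulation. The total weight `r` of the cube vertices is the unique root of `radiusFun p r = n +
1`; it determines the apex weights and signs, hence also the cube part. This gives the intersection
property (`convexHull_inter_subset_of_compatible`); existence of a root gives covering
(`octahedron_subset_octahedralExtension_space`). -/

/-- The vertices `± (n + 1) eᵢ` of the octahedron of radius `n + 1`. -/
noncomputable def apex {n : ℕ} (i : Fin n) (a : SignType) : Rn n :=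
  EuclideanSpace.single i (((n : ℝ) + 1) * (a : ℝ))

open scoped Classical in
/-- The vertices of the face of the octahedron selected by a sign vector. -/
noncomputable def apexes {n : ℕ} (ε : Fin n → SignType) : Finset (Rn n) :=
  (Finset.univ.filter (fun i => ε i ≠ 0)).image (fun i => apex i (ε i))

/-- All points of `σ` lie in the face of the cube dual to the octahedron face given by `ε`. -/
def Compatible {n : ℕ} (σ : Finset (Rn n)) (ε : Fin n → SignType) : Prop :=
  ∀ v ∈ σ, ∀ i, ε i ≠ 0 → v i = (ε i : ℝ)

/-- The octahedron of radius `n + 1`. -/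
def octahedron (n : ℕ) : Set (Rn n) :=
  {x | ∑ i, |x i| ≤ (n : ℝ) + 1}

theorem mem_octahedron {n : ℕ} {x : Rn n} : x ∈ octahedron n ↔ ∑ i, |x i| ≤ (n : ℝ) + 1 :=
  Iff.rfl

theorem SignType.abs_coe_of_ne_zero {a : SignType} (h : a ≠ 0) : |(a : ℝ)| = 1 := by
  rcases a.trichotomy with rfl | rfl | rfl <;> simp at *

theorem SignType.coe_mul_self_of_ne_zero {a : SignType} (h : a ≠ 0) : (a : ℝ) * (a : ℝ) = 1 := by
  rcases a.trichotomy with rfl | rfl | rfl <;> simp at *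

theorem SignType.coe_real_ne_zero {a : SignType} (h : a ≠ 0) : (a : ℝ) ≠ 0 := by
  rcases a.trichotomy with rfl | rfl | rfl <;> simp at *

/-! ### Apexes and weights in a join. -/

section Apexes

variable {n : ℕ}

theorem apex_apply (i j : Fin n) (a : SignType) :
    apex i a j = if j = i then ((n : ℝ) + 1) * (a : ℝ) else 0 := by
  simp [apex]

theorem apex_apply_self (i : Fin n) (a : SignType) : apex i a i = ((n : ℝ) + 1) * (a : ℝ) := by
  simp [apex_apply]

theorem neg_apex (i : Fin n) (a : SignType) : -apex i a = apex i (-a) := by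
  ext j
  simp only [PiLp.neg_apply, apex_apply, SignType.coe_neg]
  split_ifs <;> simp

theorem sum_smul_apex_apply (u : Fin n → ℝ) (ε : Fin n → SignType) (i : Fin n) :
    (∑ j, u j • apex j (ε j)) i = ((n : ℝ) + 1) * u i * (ε i : ℝ) := by
  simp only [WithLp.ofLp_sum, Finset.sum_apply, PiLp.smul_apply, apex_apply, smul_eq_mul]
  rw [Finset.sum_eq_single i]
  · simp; ring
  · intro b _ hb
    simp [hb.symm]
  · simp

theorem mem_apexes {ε : Fin n → SignType} {x : Rn n} :
    x ∈ apexes ε ↔ ∃ i, ε i ≠ 0 ∧ apex i (ε i) = x := by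
  simp [apexes]

theorem apex_mem_apexes {ε : Fin n → SignType} {i : Fin n} (h : ε i ≠ 0) :
    apex i (ε i) ∈ apexes ε :=
  mem_apexes.2 ⟨i, h, rfl⟩

theorem apex_notMem_cube (i : Fin n) {a : SignType} (h : a ≠ 0) : apex i a ∉ cube n := by
  intro hc
  have h1 := hc i
  have hn : (1 : ℝ) ≤ n := by exact_mod_cast (Nat.pos_of_ne_zero (by rintro rfl; exact i.elim0))
  rw [apex_apply_self, abs_mul, SignType.abs_coe_of_ne_zero h, abs_of_pos (by linarith)] at h1
  linarith

theorem apex_injOn (ε : Fin n → SignType) :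
    Set.InjOn (fun i => apex i (ε i)) {i | ε i ≠ 0} := by
  intro i hi j _ hij
  by_contra hne
  have h := congrArg (fun x : Rn n => x i) hij
  simp only [apex_apply, if_true, if_neg hne] at h
  have := SignType.coe_real_ne_zero hi
  have hn : (n : ℝ) + 1 ≠ 0 := by positivity
  simp [hn, this] at h

theorem disjoint_apexes {σ : Finset (Rn n)} (hσ : ↑σ ⊆ cube n) (ε : Fin n → SignType) :
    Disjoint σ (apexes ε) := by
  rw [Finset.disjoint_left]
  intro x hx hx'
  obtain ⟨i, hi, rfl⟩ := mem_apexes.1 hx'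
  exact apex_notMem_cube i hi (hσ hx)

open scoped Classical in
theorem sum_union_apexes {M : Type*} [AddCommMonoid M] {σ : Finset (Rn n)} (hσ : ↑σ ⊆ cube n)
    (ε : Fin n → SignType) (f : Rn n → M) :
    ∑ x ∈ σ ∪ apexes ε, f x = ∑ x ∈ σ, f x + ∑ i, if ε i ≠ 0 then f (apex i (ε i)) else 0 := by
  rw [Finset.sum_union (disjoint_apexes hσ ε), apexes, Finset.sum_image, Finset.sum_filter]
  intro i hi j hj h
  exact apex_injOn ε (by simpa using hi) (by simpa using hj) h

open scoped Classical in
theorem exists_weights_of_mem_convexHull {σ : Finset (Rn n)} (hσ : ↑σ ⊆ cube n)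
    {ε : Fin n → SignType} {p : Rn n} (hp : p ∈ convexHull ℝ (↑(σ ∪ apexes ε) : Set (Rn n))) :
    ∃ (w : Rn n → ℝ) (u : Fin n → ℝ), (∀ v ∈ σ, 0 ≤ w v) ∧ (∀ i, 0 ≤ u i) ∧
      (∀ i, ε i = 0 → u i = 0) ∧ ∑ v ∈ σ, w v + ∑ i, u i = 1 ∧
      p = ∑ v ∈ σ, w v • v + ∑ i, u i • apex i (ε i) := by
  obtain ⟨w, hw, hw1, rfl⟩ := Finset.mem_convexHull'.1 hp
  refine ⟨w, fun i => if ε i ≠ 0 then w (apex i (ε i)) else 0, fun v hv => hw v (by simp [hv]),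
    fun i => ?_, fun i hi => by simp [hi], ?_, ?_⟩
  · dsimp only
    split_ifs with h
    · exact hw _ (Finset.mem_union_right _ (apex_mem_apexes h))
    · exact le_rfl
  · rw [← hw1, sum_union_apexes hσ]
  · rw [sum_union_apexes hσ]
    simp only [ite_smul, zero_smul]

/-- Points of weight zero are unconstrained, so the case `r = 0` and absent apexes need no separate
treatment. -/
theorem smul_add_sum_smul_mem_convexHull {ι E : Type*} [Fintype ι] [AddCommGroup E] [Module ℝ E]
    {A : Set E} {r : ℝ} {q : E} {u : ι → ℝ} {a : ι → E} (hr : 0 ≤ r) (hu : ∀ i, 0 ≤ u i)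
    (h1 : r + ∑ i, u i = 1) (hq : r ≠ 0 → q ∈ convexHull ℝ A)
    (ha : ∀ i, u i ≠ 0 → a i ∈ A) : r • q + ∑ i, u i • a i ∈ convexHull ℝ A := by
  classical
  have key := (convex_convexHull ℝ A).sum_mem (R := ℝ)
    (t := Finset.univ.filter (fun o : Option ι => o.elim r u ≠ 0))
    (w := fun o => o.elim r u) (z := fun o => o.elim q a) ?_ ?_ ?_
  · rw [Finset.sum_filter_of_ne, Fintype.sum_option] at key
    · exact key
    · intro o _ ho h
      simp [h] at ho
  · rintro (_ | i) _
    exacts [hr, hu i]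
  · rw [Finset.sum_filter_ne_zero, Fintype.sum_option]
    exact h1
  · rintro (_ | i) hi
    · exact hq (by simpa using hi)
    · exact subset_convexHull ℝ A (ha i (by simpa using hi))

theorem inv_smul_sum_mem_convexHull {E : Type*} [AddCommGroup E] [Module ℝ E] {σ : Finset E}
    {w : E → ℝ} (hw : ∀ v ∈ σ, 0 ≤ w v) (h : ∑ v ∈ σ, w v ≠ 0) :
    (∑ v ∈ σ, w v)⁻¹ • ∑ v ∈ σ, w v • v ∈ convexHull ℝ (σ : Set E) := by
  refine Finset.mem_convexHull'.2 ⟨fun v => (∑ v ∈ σ, w v)⁻¹ * w v, fun v hv => ?_, ?_, ?_⟩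
  · exact mul_nonneg (inv_nonneg.2 (Finset.sum_nonneg hw)) (hw v hv)
  · rw [← Finset.mul_sum, inv_mul_cancel₀ h]
  · simp only [mul_smul, Finset.smul_sum]

end Apexes

/-! ### Uniqueness of barycentric coordinates. -/

section Radius

variable {n : ℕ}

/-- For `p` in the octahedron of radius `n + 1`, the equation `radiusFun p r = n + 1` determines
the total weight `r` of the cube vertices in the barycentric coordinates of `p`. -/
noncomputable def radiusFun (p : Rn n) (r : ℝ) : ℝ :=
  ∑ i, max (|p i| - r) 0 + ((n : ℝ) + 1) * r

/-- Each of the `n` maxima drops by at most `s - r`, while the linear term gains `(n + 1) * (s -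
r)`. -/
theorem radiusFun_strictMono (p : Rn n) : StrictMono (radiusFun p) := by
  intro r s hrs
  have h : ∑ i, max (|p i| - r) 0 ≤ ∑ i : Fin n, (max (|p i| - s) 0 + (s - r)) := by
    refine Finset.sum_le_sum fun i _ => max_le ?_ ?_
    · linarith [le_max_left (|p i| - s) 0]
    · linarith [le_max_right (|p i| - s) 0]
  rw [Finset.sum_add_distrib, Finset.sum_const, Finset.card_univ, Fintype.card_fin,
    nsmul_eq_mul] at h
  unfold radiusFun
  linarith

theorem exists_radiusFun_eq {p : Rn n} (hp : p ∈ octahedron n) :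
    ∃ r, 0 ≤ r ∧ r ≤ 1 ∧ radiusFun p r = (n : ℝ) + 1 := by
  have hc : Continuous (radiusFun p) := by
    unfold radiusFun
    fun_prop
  have h0 : radiusFun p 0 ≤ (n : ℝ) + 1 := by
    simpa [radiusFun] using mem_octahedron.1 hp
  have h1 : (n : ℝ) + 1 ≤ radiusFun p 1 := by
    have : 0 ≤ ∑ i, max (|p i| - 1) 0 := Finset.sum_nonneg fun i _ => le_max_right _ _
    simpa [radiusFun] using this
  obtain ⟨r, hr, h⟩ := intermediate_value_Icc zero_le_one hc.continuousOn ⟨h0, h1⟩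
  exact ⟨r, hr.1, hr.2, h⟩

theorem sum_smul_apply_of_compatible {σ : Finset (Rn n)} {ε : Fin n → SignType}
    (hc : Compatible σ ε) (w : Rn n → ℝ) {i : Fin n} (hi : ε i ≠ 0) :
    (∑ v ∈ σ, w v • v) i = (∑ v ∈ σ, w v) * (ε i : ℝ) := by
  simp only [WithLp.ofLp_sum, Finset.sum_apply, PiLp.smul_apply, smul_eq_mul, Finset.sum_mul]
  exact Finset.sum_congr rfl fun v hv => by rw [hc v hv i hi]

theorem abs_sum_smul_apply_le {σ : Finset (Rn n)} (hσ : ↑σ ⊆ cube n) {w : Rn n → ℝ}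
    (hw : ∀ v ∈ σ, 0 ≤ w v) (i : Fin n) : |(∑ v ∈ σ, w v • v) i| ≤ ∑ v ∈ σ, w v := by
  simp only [WithLp.ofLp_sum, Finset.sum_apply, PiLp.smul_apply, smul_eq_mul]
  refine (Finset.abs_sum_le_sum_abs _ _).trans (Finset.sum_le_sum fun v hv => ?_)
  rw [abs_mul, abs_of_nonneg (hw v hv)]
  exact mul_le_of_le_one_right (hw v hv) (hσ hv i)

variable {σ : Finset (Rn n)} {ε : Fin n → SignType} {w : Rn n → ℝ} {u : Fin n → ℝ} {p : Rn n}

theorem apply_eq_of_compatible (hc : Compatible σ ε)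
    (hp : p = ∑ v ∈ σ, w v • v + ∑ i, u i • apex i (ε i)) {i : Fin n} (hi : ε i ≠ 0) :
    p i = (∑ v ∈ σ, w v + ((n : ℝ) + 1) * u i) * (ε i : ℝ) := by
  rw [hp, PiLp.add_apply, sum_smul_apply_of_compatible hc w hi, sum_smul_apex_apply]
  ring

/-- Where `ε i ≠ 0`, the cube part has coordinate `r * ε i` exactly and the apex pushes it further
out; elsewhere only the cube part contributes, with absolute value at most `r`. -/
theorem max_abs_sub_eq (hσ : ↑σ ⊆ cube n) (hc : Compatible σ ε) (hw : ∀ v ∈ σ, 0 ≤ w v)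
    (hu : ∀ i, 0 ≤ u i) (hu0 : ∀ i, ε i = 0 → u i = 0)
    (hp : p = ∑ v ∈ σ, w v • v + ∑ i, u i • apex i (ε i)) (i : Fin n) :
    max (|p i| - ∑ v ∈ σ, w v) 0 = ((n : ℝ) + 1) * u i := by
  have hr : 0 ≤ ∑ v ∈ σ, w v := Finset.sum_nonneg hw
  have hnu : 0 ≤ ((n : ℝ) + 1) * u i := mul_nonneg (by positivity) (hu i)
  by_cases hi : ε i = 0
  · have h : p i = (∑ v ∈ σ, w v • v) i := by
      rw [hp, PiLp.add_apply, sum_smul_apex_apply, hu0 i hi]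
      ring
    rw [h, hu0 i hi, mul_zero]
    exact max_eq_right (sub_nonpos.2 (abs_sum_smul_apply_le hσ hw i))
  · rw [apply_eq_of_compatible hc hp hi, abs_mul, SignType.abs_coe_of_ne_zero hi, mul_one,
      abs_of_nonneg (add_nonneg hr hnu), add_sub_cancel_left, max_eq_left hnu]

theorem radiusFun_sum_weights (hσ : ↑σ ⊆ cube n) (hc : Compatible σ ε) (hw : ∀ v ∈ σ, 0 ≤ w v)
    (hu : ∀ i, 0 ≤ u i) (hu0 : ∀ i, ε i = 0 → u i = 0) (h1 : ∑ v ∈ σ, w v + ∑ i, u i = 1)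
    (hp : p = ∑ v ∈ σ, w v • v + ∑ i, u i • apex i (ε i)) :
    radiusFun p (∑ v ∈ σ, w v) = (n : ℝ) + 1 := by
  rw [radiusFun, Finset.sum_congr rfl fun i _ => max_abs_sub_eq hσ hc hw hu hu0 hp i,
    ← Finset.mul_sum, ← mul_add, add_comm (∑ i, u i), h1, mul_one]

open scoped Classical in
-- In a dependence with cube weight `ρ`, each coordinate with `ε i ≠ 0` forces `(n + 1) * u i = -ρ`.
-- With `k ≤ n` such coordinates and total weight zero, `(n + 1 - k) * ρ = 0`, so every apex weight
-- vanishes and independence of `σ` finishes.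
theorem affineIndependent_union_apexes (hσ : ↑σ ⊆ cube n) (hc : Compatible σ ε)
    (hi : AffineIndependent ℝ ((↑) : σ → Rn n)) :
    AffineIndependent ℝ ((↑) : ↥(σ ∪ apexes ε) → Rn n) := by
  rw [affineIndependent_iff_of_fintype]
  intro W hW0 hW
  rw [Finset.weightedVSub_eq_linear_combination _ hW0] at hW
  set f : Rn n → ℝ := fun x => if h : x ∈ σ ∪ apexes ε then W ⟨x, h⟩ else 0 with hf
  have hfW : ∀ x : ↥(σ ∪ apexes ε), W x = f x := fun x => by
    simp only [hf, dif_pos x.2]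
  simp only [hfW] at hW0 hW ⊢
  rw [Finset.sum_coe_sort (σ ∪ apexes ε) f, sum_union_apexes hσ] at hW0
  rw [Finset.sum_coe_sort (σ ∪ apexes ε) (fun x => f x • x), sum_union_apexes hσ] at hW
  set u : Fin n → ℝ := fun i => if ε i ≠ 0 then f (apex i (ε i)) else 0 with hu
  set ρ := ∑ v ∈ σ, f v with hρ
  have hW' : (0 : Rn n) = ∑ v ∈ σ, f v • v + ∑ i, u i • apex i (ε i) := by
    rw [← hW]
    simp only [hu, ite_smul, zero_smul]
  have hui : ∀ i, ε i ≠ 0 → ((n : ℝ) + 1) * u i = -ρ := by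
    intro i hi
    have h := apply_eq_of_compatible hc hW' hi
    have h' := (mul_eq_zero.1 h.symm).resolve_right (SignType.coe_real_ne_zero hi)
    linarith
  have hn : (n : ℝ) + 1 ≠ 0 := by positivity
  have hsum : ((n : ℝ) + 1) * ∑ i, u i =
      -((Finset.univ.filter fun i => ε i ≠ 0).card : ℝ) * ρ := by
    rw [Finset.mul_sum, neg_mul, ← mul_neg, ← nsmul_eq_mul, ← Finset.sum_const,
      Finset.sum_filter]
    refine Finset.sum_congr rfl fun i _ => ?_
    split_ifs with h
    · exact hui i h
    · simp [hu, h]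
  have hcard : ((Finset.univ.filter fun i => ε i ≠ 0).card : ℝ) ≤ n := by
    exact_mod_cast (Finset.card_le_univ _).trans_eq (Fintype.card_fin n)
  have hρ0 : ρ = 0 := by
    have h : ((n : ℝ) + 1 - ((Finset.univ.filter fun i => ε i ≠ 0).card : ℝ)) * ρ = 0 := by
      linear_combination ((n : ℝ) + 1) * hW0 - hsum
    exact (mul_eq_zero.1 h).resolve_left (by linarith)
  have hu0 : ∀ i, u i = 0 := by
    intro i
    by_cases h : ε i = 0
    · simp [hu, h]
    · have := hui i h
      rw [hρ0, neg_zero] at this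
      exact (mul_eq_zero.1 this).resolve_left hn
  have hσ0 : ∑ v ∈ σ, f v • v = 0 := by
    simpa [hu0] using hW'.symm
  have hfσ : ∀ v ∈ σ, f v = 0 := by
    intro v hv
    refine affineIndependent_iff.1 hi Finset.univ (fun x => f x) ?_ ?_ ⟨v, hv⟩ (Finset.mem_univ _)
    · exact (Finset.sum_coe_sort σ f).trans hρ0
    · exact (Finset.sum_coe_sort σ (fun x => f x • x)).trans hσ0
  rintro ⟨x, hx⟩
  rcases Finset.mem_union.1 hx with h | h
  · exact hfσ x h
  · obtain ⟨i, hi, rfl⟩ := mem_apexes.1 h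
    simpa [hu, hi] using hu0 i

open scoped Classical in
theorem convexHull_inter_subset_of_compatible {τ : Finset (Rn n)} {δ : Fin n → SignType}
    (hσ : ↑σ ⊆ cube n) (hτ : ↑τ ⊆ cube n) (hc : Compatible σ ε) (hd : Compatible τ δ)
    (hστ : convexHull ℝ (σ : Set (Rn n)) ∩ convexHull ℝ (τ : Set (Rn n)) ⊆
      convexHull ℝ (σ ∩ τ : Set (Rn n))) :
    convexHull ℝ (↑(σ ∪ apexes ε) : Set (Rn n)) ∩ convexHull ℝ (↑(τ ∪ apexes δ) : Set (Rn n)) ⊆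
      convexHull ℝ (↑(σ ∪ apexes ε) ∩ ↑(τ ∪ apexes δ) : Set (Rn n)) := by
  rintro p ⟨hp, hp'⟩
  obtain ⟨w, u, hw, hu, hu0, h1, hp⟩ := exists_weights_of_mem_convexHull hσ hp
  obtain ⟨w', u', hw', hu', hu0', h1', hp'⟩ := exists_weights_of_mem_convexHull hτ hp'
  have hn : (0 : ℝ) < (n : ℝ) + 1 := by positivity
  have hr : ∑ v ∈ σ, w v = ∑ v ∈ τ, w' v := (radiusFun_strictMono p).injective <|
    (radiusFun_sum_weights hσ hc hw hu hu0 h1 hp).trans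
      (radiusFun_sum_weights hτ hd hw' hu' hu0' h1' hp').symm
  have huu : ∀ i, u i = u' i := fun i => by
    have h := max_abs_sub_eq hσ hc hw hu hu0 hp i
    rw [hr, max_abs_sub_eq hτ hd hw' hu' hu0' hp' i] at h
    exact (mul_left_cancel₀ hn.ne' h).symm
  have hne : ∀ i, u i ≠ 0 → ε i ≠ 0 := fun i h h' => h (hu0 i h')
  have hne' : ∀ i, u i ≠ 0 → δ i ≠ 0 := fun i h h' => h ((huu i).trans (hu0' i h'))
  have hεδ : ∀ i, u i ≠ 0 → apex i (ε i) = apex i (δ i) := by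
    intro i hi
    have h := apply_eq_of_compatible hc hp (hne i hi)
    rw [apply_eq_of_compatible hd hp' (hne' i hi), ← hr, ← huu i] at h
    have hpos : ∑ v ∈ σ, w v + ((n : ℝ) + 1) * u i ≠ 0 :=
      (add_pos_of_nonneg_of_pos (Finset.sum_nonneg hw)
        (mul_pos hn ((hu i).lt_of_ne' hi))).ne'
    rw [apex, apex, mul_left_cancel₀ hpos h]
  have hy : ∑ v ∈ σ, w v • v = ∑ v ∈ τ, w' v • v := by
    have h : ∑ i, u i • apex i (ε i) = ∑ i, u' i • apex i (δ i) :=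
      Finset.sum_congr rfl fun i _ => by
        by_cases hi : u i = 0
        · simp [← huu i, hi]
        · rw [← huu i, hεδ i hi]
    rw [hp, h] at hp'
    exact add_right_cancel hp'
  -- If the cube weight is zero, all `w v` vanish and the value `0⁻¹ = 0` is harmless.
  have hq : p = (∑ v ∈ σ, w v) • ((∑ v ∈ σ, w v)⁻¹ • ∑ v ∈ σ, w v • v) +
      ∑ i, u i • apex i (ε i) := by
    by_cases h : ∑ v ∈ σ, w v = 0
    · have h0 : ∑ v ∈ σ, w v • v = 0 := Finset.sum_eq_zero fun v hv => by
        rw [(Finset.sum_eq_zero_iff_of_nonneg hw).1 h v hv, zero_smul]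
      rw [hp, h0, h]
      simp
    · rw [smul_inv_smul₀ h]
      exact hp
  rw [hq]
  refine smul_add_sum_smul_mem_convexHull (Finset.sum_nonneg hw) hu h1 (fun h => ?_) fun i hi => ?_
  · refine convexHull_mono ?_ (hστ ⟨inv_smul_sum_mem_convexHull hw h, ?_⟩)
    · intro x hx
      exact ⟨by simp [Finset.mem_coe.1 hx.1], by simp [Finset.mem_coe.1 hx.2]⟩
    · rw [hr, hy]
      exact inv_smul_sum_mem_convexHull hw' (hr ▸ h)
  · refine ⟨Finset.mem_union_right _ (apex_mem_apexes (hne i hi)), ?_⟩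
    rw [hεδ i hi]
    exact Finset.mem_union_right _ (apex_mem_apexes (hne' i hi))

end Radius

/-! ### The octahedron as a symmetric ball around the cube. -/

section Octahedron

variable {n : ℕ}

theorem convex_octahedron (n : ℕ) : Convex ℝ (octahedron n) := by
  intro x hx y hy a b ha hb hab
  have h : ∑ i, |(a • x + b • y) i| ≤ a * ∑ i, |x i| + b * ∑ i, |y i| := by
    rw [Finset.mul_sum, Finset.mul_sum, ← Finset.sum_add_distrib]
    refine Finset.sum_le_sum fun i _ => (abs_add_le _ _).trans_eq ?_
    simp [abs_mul, abs_of_nonneg ha, abs_of_nonneg hb]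
  refine h.trans ?_
  calc a * ∑ i, |x i| + b * ∑ i, |y i| ≤ a * ((n : ℝ) + 1) + b * ((n : ℝ) + 1) :=
        add_le_add (mul_le_mul_of_nonneg_left hx ha) (mul_le_mul_of_nonneg_left hy hb)
    _ = (n : ℝ) + 1 := by rw [← add_mul, hab, one_mul]

theorem isClosed_octahedron (n : ℕ) : IsClosed (octahedron n) :=
  isClosed_le (by fun_prop) continuous_const

theorem isBounded_octahedron (n : ℕ) : Bornology.IsBounded (octahedron n) := by
  refine (Metric.isBounded_closedBall (x := (0 : Rn n)) (r := (n : ℝ) + 1)).subset fun x hx => ?_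
  rw [mem_closedBall_zero_iff]
  have h : x = ∑ i, EuclideanSpace.single i (x i) := by
    ext j
    simp [Pi.single_apply]
  rw [h]
  refine (norm_sum_le _ _).trans ?_
  simpa using mem_octahedron.1 hx

theorem cube_subset_interior_octahedron (n : ℕ) : cube n ⊆ interior (octahedron n) := by
  have ho : IsOpen {x : Rn n | ∑ i, |x i| < (n : ℝ) + 1} :=
    isOpen_lt (by fun_prop) continuous_const
  refine fun x hx => interior_maximal (t := {x : Rn n | ∑ i, |x i| < (n : ℝ) + 1})
    (fun y hy => mem_octahedron.2 (le_of_lt hy)) ho ?_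
  have : ∑ i, |x i| ≤ ∑ _i : Fin n, (1 : ℝ) := Finset.sum_le_sum fun i _ => hx i
  simp only [Finset.sum_const, Finset.card_univ, Fintype.card_fin, nsmul_eq_mul, mul_one] at this
  exact (this.trans_lt (lt_add_one _) : _ < _)

theorem isTopologicalBall_octahedron (n : ℕ) : IsTopologicalBall (octahedron n) := by
  obtain ⟨e, -, he, -⟩ := exists_homeomorph_image_interior_closure_frontier_eq_unitBall
    (convex_octahedron n) ⟨0, cube_subset_interior_octahedron n (by simp [cube])⟩
    (isBounded_octahedron n)
  rw [(isClosed_octahedron n).closure_eq] at he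
  exact ⟨(e.image _).trans (Homeomorph.setCongr he)⟩

theorem apex_mem_octahedron (i : Fin n) (a : SignType) : apex i a ∈ octahedron n := by
  have hn : (0 : ℝ) ≤ (n : ℝ) + 1 := by positivity
  have ha : |(a : ℝ)| ≤ 1 := by rcases a.trichotomy with rfl | rfl | rfl <;> simp
  simp only [mem_octahedron, apex_apply]
  rw [Finset.sum_eq_single i (fun j _ hj => by simp [hj]) (by simp), if_pos rfl, abs_mul,
    abs_of_nonneg hn]
  exact mul_le_of_le_one_right hn ha

theorem neg_mem_frontier_octahedron {x : Rn n} (hx : x ∈ frontier (octahedron n)) :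
    -x ∈ frontier (octahedron n) := by
  have h : (Homeomorph.neg (Rn n)) ⁻¹' octahedron n = octahedron n := by
    ext y
    simp [octahedron]
  have := (Homeomorph.neg (Rn n)).preimage_frontier (octahedron n)
  rw [h] at this
  rw [← this] at hx
  exact hx

end Octahedron

/-! ### The extended triangulation. -/

section Extension

variable {n : ℕ}

/-- Discarding vertices of weight zero leaves `q` a strictly positive combination; a coordinate
equal to `±1` at `q` is then extremal, hence takes that value at every remaining vertex. -/
theorem exists_compatible_face_of_mem_cube {K : Geometry.SimplicialComplex ℝ (Rn n)}
    (hK : K.space = cube n) {q : Rn n} (hq : q ∈ cube n) :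
    ∃ σ ∈ K.faces, q ∈ convexHull ℝ (σ : Set (Rn n)) ∧
      ∀ ε : Fin n → SignType, (∀ i, ε i ≠ 0 → q i = (ε i : ℝ)) → Compatible σ ε := by
  classical
  rw [← hK, Geometry.SimplicialComplex.mem_space_iff] at hq
  obtain ⟨s, hs, hq⟩ := hq
  obtain ⟨w, hw, hw1, hwq⟩ := Finset.mem_convexHull'.1 hq
  have hsub : s.filter (fun v => w v ≠ 0) ⊆ s := Finset.filter_subset _ _
  have hw1' : ∑ v ∈ s.filter (fun v => w v ≠ 0), w v = 1 := by
    rw [Finset.sum_filter_ne_zero, hw1]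
  have hwq' : ∑ v ∈ s.filter (fun v => w v ≠ 0), w v • v = q := by
    rw [Finset.sum_filter_of_ne, hwq]
    intro v _ hv h
    simp [h] at hv
  have hne : (s.filter (fun v => w v ≠ 0)).Nonempty :=
    Finset.nonempty_of_sum_ne_zero (f := w) (by rw [hw1']; exact one_ne_zero)
  refine ⟨_, K.down_closed hs hsub hne,
    Finset.mem_convexHull'.2 ⟨w, fun v hv => hw v (hsub hv), hw1', hwq'⟩, ?_⟩
  intro ε hε v hv i hi
  have hcube : ∀ x ∈ s, |x i| ≤ 1 := fun x hx => by
    have : x ∈ cube n := hK ▸ Geometry.SimplicialComplex.subset_space hs hx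
    exact this i
  have hsq := SignType.coe_mul_self_of_ne_zero hi
  have hle : ∀ x ∈ s, (ε i : ℝ) * x i ≤ 1 := fun x hx => by
    refine (le_abs_self _).trans ?_
    rw [abs_mul, SignType.abs_coe_of_ne_zero hi, one_mul]
    exact hcube x hx
  have hz : ∑ x ∈ s, w x * (1 - (ε i : ℝ) * x i) = 0 := by
    have h : q i = ∑ x ∈ s, w x * x i := by
      rw [← hwq]
      simp
    have h2 : ∑ x ∈ s, w x * (1 - (ε i : ℝ) * x i) =
        ∑ x ∈ s, w x - (ε i : ℝ) * ∑ x ∈ s, w x * x i := by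
      rw [Finset.mul_sum, ← Finset.sum_sub_distrib]
      exact Finset.sum_congr rfl fun x _ => by ring
    rw [h2, hw1, ← h, hε i hi, hsq, sub_self]
  have h0 := (Finset.sum_eq_zero_iff_of_nonneg fun x hx =>
    mul_nonneg (hw x hx) (sub_nonneg.2 (hle x hx))).1 hz v (hsub hv)
  have h1 := (mul_eq_zero.1 h0).resolve_left (Finset.mem_filter.1 hv).2
  linear_combination (-(v i)) * hsq - (ε i : ℝ) * h1

theorem cube_of_mem_or_empty {K : Geometry.SimplicialComplex ℝ (Rn n)} (hK : K.space = cube n)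
    {σ : Finset (Rn n)} (hσ : σ = ∅ ∨ σ ∈ K.faces) : ↑σ ⊆ cube n := by
  rcases hσ with rfl | hσ
  · simp
  · exact hK ▸ Geometry.SimplicialComplex.subset_space hσ

open scoped Classical in
/-- The triangulation of the octahedron of radius `n + 1` that extends a triangulation of the cube:
every simplex in a face of the cube is joined with the dual faces of the octahedron. -/
noncomputable def octahedralExtension (K : Geometry.SimplicialComplex ℝ (Rn n))
    (hK : K.space = cube n) : Geometry.SimplicialComplex ℝ (Rn n) where
  -- `σ = ∅` supplies the simplices spanned by apexes alone, among them all boundary simplices.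
  faces := {s | s.Nonempty ∧ ∃ σ ε, (σ = ∅ ∨ σ ∈ K.faces) ∧ Compatible σ ε ∧ s = σ ∪ apexes ε}
  isRelLowerSet_faces := by
    rintro s ⟨hs, σ, ε, hσ, hc, rfl⟩
    refine ⟨hs, fun t ht htne => ⟨htne, t ∩ σ,
      -- Erasing the signs of the missing apexes only weakens compatibility.
      fun i => if apex i (ε i) ∈ t then ε i else 0, ?_, ?_, ?_⟩⟩
    · rcases hσ with rfl | hσ
      · simp
      · rcases (t ∩ σ).eq_empty_or_nonempty with h | h
        · exact Or.inl h
        · exact Or.inr (K.down_closed hσ Finset.inter_subset_right h)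
    · intro v hv i hi
      dsimp only at hi ⊢
      split_ifs at hi ⊢ with h
      · exact hc v (Finset.mem_inter.1 hv).2 i hi
      · exact absurd rfl hi
    · ext x
      simp only [Finset.mem_union, Finset.mem_inter, mem_apexes]
      constructor
      · intro hx
        rcases Finset.mem_union.1 (ht hx) with h | h
        · exact Or.inl ⟨hx, h⟩
        · obtain ⟨i, hi, rfl⟩ := mem_apexes.1 h
          exact Or.inr ⟨i, by simp [hx, hi], by simp [hx]⟩
      · rintro (h | ⟨i, hi, rfl⟩)
        · exact h.1
        · split_ifs at hi ⊢ with h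
          · exact h
          · exact absurd rfl hi
  indep := by
    rintro s ⟨-, σ, ε, hσ, hc, rfl⟩
    refine affineIndependent_union_apexes (cube_of_mem_or_empty hK hσ) hc ?_
    rcases hσ with rfl | hσ
    · exact affineIndependent_of_subsingleton _ _
    · exact K.indep hσ
  inter_subset_convexHull := by
    rintro s t ⟨-, σ, ε, hσ, hc, rfl⟩ ⟨-, τ, δ, hτ, hd, rfl⟩
    refine convexHull_inter_subset_of_compatible (cube_of_mem_or_empty hK hσ)
      (cube_of_mem_or_empty hK hτ) hc hd ?_
    rcases hσ with rfl | hσ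
    · simp
    rcases hτ with rfl | hτ
    · simp
    exact K.inter_subset_convexHull hσ hτ

variable {K : Geometry.SimplicialComplex ℝ (Rn n)} {hK : K.space = cube n}

open scoped Classical in
theorem mem_octahedralExtension_faces {s : Finset (Rn n)} :
    s ∈ (octahedralExtension K hK).faces ↔ s.Nonempty ∧
      ∃ σ ε, (σ = ∅ ∨ σ ∈ K.faces) ∧ Compatible σ ε ∧ s = σ ∪ apexes ε :=
  Iff.rfl

theorem octahedralExtension_faces_finite (h : K.faces.Finite) :
    (octahedralExtension K hK).faces.Finite := by
  classical
  refine (((h.insert ∅).prod (Set.finite_univ (α := Fin n → SignType))).image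
    fun x => x.1 ∪ apexes x.2).subset ?_
  rintro s ⟨-, σ, ε, hσ, -, rfl⟩
  exact ⟨(σ, ε), ⟨hσ, Set.mem_univ _⟩, rfl⟩

theorem octahedron_subset_octahedralExtension_space :
    octahedron n ⊆ (octahedralExtension K hK).space := by
  classical
  intro p hp
  obtain ⟨r, hr0, -, hr⟩ := exists_radiusFun_eq hp
  have hn : (0 : ℝ) < (n : ℝ) + 1 := by positivity
  -- Clipping the coordinates of `p` to `[-r, r]` gives `y`; the excess is carried by the apexes. If
  -- `r > 0`, then `r⁻¹ • y` lies in the cube face prescribed by `ε`.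
  set u : Fin n → ℝ := fun i => max (|p i| - r) 0 / ((n : ℝ) + 1) with hu
  set ε : Fin n → SignType := fun i => if r < |p i| then SignType.sign (p i) else 0 with hε
  set y : Rn n := p - ∑ i, u i • apex i (ε i) with hy
  have hu1 : r + ∑ i, u i = 1 := by
    rw [radiusFun] at hr
    rw [hu, ← Finset.sum_div]
    field_simp
    linarith
  have hu0 : ∀ i, 0 ≤ u i := fun i => div_nonneg (le_max_right _ _) hn.le
  have hyi : ∀ i, y i = p i - max (|p i| - r) 0 * (ε i : ℝ) := fun i => by
    rw [hy, PiLp.sub_apply, sum_smul_apex_apply, hu]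
    field_simp
  have hεr : ∀ i, ε i ≠ 0 → r < |p i| := fun i hi => by
    by_contra h
    simp [hε, h] at hi
  have hyε : ∀ i, r < |p i| → y i = r * (ε i : ℝ) := fun i hi => by
    have h1 : (ε i : ℝ) = (SignType.sign (p i) : ℝ) := by simp [hε, hi]
    have h2 : p i = |p i| * (SignType.sign (p i) : ℝ) := (abs_mul_sign _).symm
    rw [hyi, h1, max_eq_left (by linarith)]
    linear_combination h2
  have hyr : ∀ i, |y i| ≤ r := fun i => by
    by_cases hi : r < |p i|
    · rw [hyε i hi, abs_mul, abs_of_nonneg hr0]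
      refine mul_le_of_le_one_right hr0 ?_
      rcases (ε i).trichotomy with h | h | h <;> simp [h]
    · rw [hyi, max_eq_right (by linarith), zero_mul, sub_zero]
      exact not_lt.1 hi
  have hpy : p = y + ∑ i, u i • apex i (ε i) := by rw [hy, sub_add_cancel]
  have hapex : ∀ i, u i ≠ 0 → ε i ≠ 0 := fun i hi => by
    have h : r < |p i| := by
      by_contra h
      exact hi (by simp [hu, max_eq_right (show |p i| - r ≤ 0 by linarith)])
    have hp0 : p i ≠ 0 := abs_pos.1 (hr0.trans_lt h)
    simpa [hε, h] using hp0
  obtain ⟨σ, q, hσ, hc, hyq, hq⟩ : ∃ (σ : Finset (Rn n)) (q : Rn n),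
      (σ = ∅ ∨ σ ∈ K.faces) ∧ Compatible σ ε ∧ y = r • q ∧
        (r ≠ 0 → q ∈ convexHull ℝ (σ : Set (Rn n))) := by
    by_cases h : r = 0
    · refine ⟨∅, 0, Or.inl rfl, by simp [Compatible], ?_, fun h' => absurd h h'⟩
      ext i
      simpa [h] using hyr i
    · have hrpos : 0 < r := hr0.lt_of_ne' h
      have hqc : r⁻¹ • y ∈ cube n := fun i => by
        rw [PiLp.smul_apply, smul_eq_mul, abs_mul, abs_of_pos (inv_pos.2 hrpos),
          inv_mul_le_one₀ hrpos]
        exact hyr i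
      obtain ⟨σ, hσ, hq, hc⟩ := exists_compatible_face_of_mem_cube hK hqc
      refine ⟨σ, r⁻¹ • y, Or.inr hσ, hc ε fun i hi => ?_, (smul_inv_smul₀ h y).symm, fun _ => hq⟩
      rw [PiLp.smul_apply, hyε i (hεr i hi), smul_eq_mul, inv_mul_cancel_left₀ h]
  have hmem : p ∈ convexHull ℝ (↑(σ ∪ apexes ε) : Set (Rn n)) := by
    rw [hpy, hyq]
    refine smul_add_sum_smul_mem_convexHull hr0 hu0 hu1 (fun h => ?_) fun i hi => ?_
    · exact convexHull_mono (by simp) (hq h)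
    · exact Finset.mem_union_right _ (apex_mem_apexes (hapex i hi))
  refine Geometry.SimplicialComplex.mem_space_iff.2
    ⟨_, mem_octahedralExtension_faces.2 ⟨?_, σ, ε, hσ, hc, rfl⟩, hmem⟩
  exact Finset.coe_nonempty.1 (convexHull_nonempty_iff.1 ⟨p, hmem⟩)

theorem octahedralExtension_space : (octahedralExtension K hK).space = octahedron n := by
  classical
  refine Set.Subset.antisymm (fun p hp => ?_) octahedron_subset_octahedralExtension_space
  obtain ⟨s, ⟨-, σ, ε, hσ, -, rfl⟩, hp⟩ := Geometry.SimplicialComplex.mem_space_iff.1 hp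
  refine convexHull_min (fun x hx => ?_) (convex_octahedron n) hp
  rcases Finset.mem_union.1 hx with h | h
  · exact interior_subset (cube_subset_interior_octahedron n (cube_of_mem_or_empty hK hσ h))
  · obtain ⟨i, -, rfl⟩ := mem_apexes.1 h
    exact apex_mem_octahedron i _

theorem mem_octahedralExtension_vertices {v : Rn n}
    (hv : v ∈ (octahedralExtension K hK).vertices) :
    v ∈ K.vertices ∨ ∃ i, ∃ a : SignType, a ≠ 0 ∧ v = apex i a := by
  classical
  obtain ⟨-, σ, ε, hσ, -, h⟩ := hv
  rcases Finset.mem_union.1 (h ▸ Finset.mem_singleton_self v) with hv | hv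
  · rcases hσ with rfl | hσ
    · simp at hv
    · exact Or.inl (K.down_closed hσ (by simpa using hv) (by simp))
  · obtain ⟨i, hi, rfl⟩ := mem_apexes.1 hv
    exact Or.inr ⟨i, ε i, hi, rfl⟩

theorem isAntipodallySymmetricOnBoundary_octahedralExtension :
    IsAntipodallySymmetricOnBoundary (octahedralExtension K hK) := by
  classical
  rintro s ⟨⟨hne, σ, ε, hσ, -, rfl⟩, hs⟩
  rw [octahedralExtension_space] at hs
  -- A cube vertex would be an interior point of the octahedron.
  obtain rfl : σ = ∅ := by
    refine Finset.eq_empty_of_forall_notMem fun v hv => ?_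
    refine (hs (subset_convexHull ℝ _ (Finset.mem_union_left _ hv))).2 ?_
    exact cube_subset_interior_octahedron n (cube_of_mem_or_empty hK hσ hv)
  refine ⟨⟨hne.map, ∅, fun i => -ε i, Or.inl rfl, by simp [Compatible], ?_⟩, ?_⟩
  · ext x
    simp only [Finset.empty_union, Finset.mem_map, mem_apexes, Equiv.coe_toEmbedding,
      Equiv.neg_apply, ne_eq, SignType.neg_eq_zero_iff]
    constructor
    · rintro ⟨_, ⟨i, hi, rfl⟩, rfl⟩
      exact ⟨i, hi, (neg_apex _ _).symm⟩
    · rintro ⟨i, hi, rfl⟩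
      exact ⟨_, ⟨i, hi, rfl⟩, neg_apex _ _⟩
  · rw [octahedralExtension_space]
    intro x hx
    have h : -x ∈ convexHull ℝ (↑(∅ ∪ apexes ε) : Set (Rn n)) := by
      rw [Finset.coe_map, Equiv.coe_toEmbedding] at hx
      change x ∈ convexHull ℝ ((fun y : Rn n => -y) '' _) at hx
      rw [Set.image_neg_eq_neg, convexHull_neg] at hx
      exact hx
    simpa using neg_mem_frontier_octahedron (hs h)

/-! ### The extended labelling and its complementary edges. -/

open scoped Classical in
/-- The extension of a labelling of the cube that labels the apex `± (n + 1) eᵢ` by `± eᵢ`. -/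
noncomputable def extendedLabel (lab : Rn n → Rn n) (v : Rn n) : Rn n :=
  if v ∈ cube n then lab v else ((n : ℝ) + 1)⁻¹ • v

theorem extendedLabel_of_mem_cube (lab : Rn n → Rn n) {v : Rn n} (hv : v ∈ cube n) :
    extendedLabel lab v = lab v :=
  if_pos hv

theorem extendedLabel_apex (lab : Rn n → Rn n) (i : Fin n) {a : SignType} (ha : a ≠ 0) :
    extendedLabel lab (apex i a) = EuclideanSpace.single i (a : ℝ) := by
  rw [extendedLabel, if_neg (apex_notMem_cube i ha)]
  have hn : (n : ℝ) + 1 ≠ 0 := by positivity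
  ext j
  simp only [PiLp.smul_apply, apex_apply, smul_eq_mul, PiLp.single_apply]
  split_ifs <;> simp [hn]

theorem isOctahedralLabelling_extendedLabel {lab : Rn n → Rn n}
    (hlab : IsOctahedralLabelling K lab) :
    IsOctahedralLabelling (octahedralExtension K hK) (extendedLabel lab) := by
  intro v hv
  rcases mem_octahedralExtension_vertices hv with h | ⟨i, a, ha, rfl⟩
  · rw [extendedLabel_of_mem_cube lab (hK ▸ K.vertices_subset_space h)]
    exact hlab v h
  · rw [extendedLabel_apex lab i ha]
    refine ⟨i, ?_⟩
    rcases a.trichotomy with rfl | rfl | rfl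
    · right
      ext j
      simp [PiLp.single_apply, apply_ite]
    · exact absurd rfl ha
    · simp

theorem extendedLabel_neg_of_mem_frontier (lab : Rn n → Rn n) {v : Rn n}
    (hv : v ∈ (octahedralExtension K hK).vertices) (hf : v ∈ frontier (octahedron n)) :
    extendedLabel lab v = -extendedLabel lab (-v) := by
  rcases mem_octahedralExtension_vertices hv with h | ⟨i, a, ha, rfl⟩
  · exact absurd (cube_subset_interior_octahedron n (hK ▸ K.vertices_subset_space h)) hf.2
  · have ha' : -a ≠ 0 := by simpa [SignType.neg_eq_zero_iff] using ha
    rw [neg_apex, extendedLabel_apex lab i ha, extendedLabel_apex lab i ha']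
    ext j
    simp only [PiLp.neg_apply, PiLp.single_apply, SignType.coe_neg]
    split_ifs <;> simp

/-- Compatibility gives `v i = ε i`, so the Sperner condition at `v` excludes exactly the label
opposite to that of the apex. -/
theorem extendedLabel_ne_neg_apex {σ : Finset (Rn n)} {ε : Fin n → SignType} {lab : Rn n → Rn n}
    (hσ : σ = ∅ ∨ σ ∈ K.faces) (hK : K.space = cube n) (hc : Compatible σ ε)
    (hlab : ∀ x ∈ K.vertices, ∀ i : Fin n, (x i = -1 ∨ x i = 1) →
      lab x ≠ -(x i • EuclideanSpace.single i (1 : ℝ)))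
    {v : Rn n} (hv : v ∈ σ) {i : Fin n} (hi : ε i ≠ 0) :
    extendedLabel lab v ≠ -extendedLabel lab (apex i (ε i)) := by
  have hvi := hc v hv i hi
  have hvK : v ∈ K.vertices := by
    rcases hσ with rfl | hσ
    · simp at hv
    · exact K.down_closed hσ (by simpa using hv) (by simp)
  have hpm : v i = -1 ∨ v i = 1 := by
    rw [hvi]
    rcases (ε i).trichotomy with h | h | h
    · simp [h]
    · exact absurd h hi
    · simp [h]
  have h := hlab v hvK i hpm
  rw [extendedLabel_of_mem_cube lab (hK ▸ K.vertices_subset_space hvK),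
    extendedLabel_apex lab i hi]
  convert! h using 2
  ext j
  simp [PiLp.single_apply, hvi]

theorem hasComplementaryEdge_of_octahedralExtension {lab : Rn n → Rn n}
    (hlab : ∀ x ∈ K.vertices, ∀ i : Fin n, (x i = -1 ∨ x i = 1) →
      lab x ≠ -(x i • EuclideanSpace.single i (1 : ℝ)))
    (h : HasComplementaryEdge (octahedralExtension K hK) (extendedLabel lab)) :
    HasComplementaryEdge K lab := by
  classical
  obtain ⟨s, ⟨-, σ, ε, hσ, hc, rfl⟩, v, hv, x, hx, hvx⟩ := h
  rcases Finset.mem_union.1 hv with hv | hv <;> rcases Finset.mem_union.1 hx with hx | hx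
  · have hcube := cube_of_mem_or_empty hK hσ
    rw [extendedLabel_of_mem_cube lab (hcube hv), extendedLabel_of_mem_cube lab (hcube hx)] at hvx
    rcases hσ with rfl | hσ
    · simp at hv
    · exact ⟨σ, hσ, v, hv, x, hx, hvx⟩
  · obtain ⟨i, hi, rfl⟩ := mem_apexes.1 hx
    exact absurd hvx (extendedLabel_ne_neg_apex hσ hK hc hlab hv hi)
  · obtain ⟨i, hi, rfl⟩ := mem_apexes.1 hv
    exact absurd (by rw [hvx, neg_neg]) (extendedLabel_ne_neg_apex hσ hK hc hlab hx hi)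
  -- Opposite labels would put both apexes on the same axis, where `ε` allows only one sign.
  · obtain ⟨i, hi, rfl⟩ := mem_apexes.1 hv
    obtain ⟨j, hj, rfl⟩ := mem_apexes.1 hx
    rw [extendedLabel_apex lab i hi, extendedLabel_apex lab j hj] at hvx
    have h := congrArg (fun y : Rn n => y i) hvx
    have hne := SignType.coe_real_ne_zero hi
    by_cases hij : i = j
    · subst hij
      simp only [PiLp.neg_apply, PiLp.single_apply, if_true] at h
      exact absurd (by linarith) hne
    · simp [hij] at h
      exact absurd h hne

end Extension

theorem mainTheorem5 (n : ℕ) (hn : 1 ≤ n) :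
    TuckerLemma n → CubicalSpernerOctahedralLabels n := by
  intro hT K lab hK hlab hbd
  refine hasComplementaryEdge_of_octahedralExtension (hK := hK.2) hbd
    (hT (octahedron n) _ _ (isTopologicalBall_octahedron n)
      ⟨octahedralExtension_faces_finite hK.1, octahedralExtension_space⟩
      isAntipodallySymmetricOnBoundary_octahedralExtension
      (isOctahedralLabelling_extendedLabel hlab)
      fun v hv hf => extendedLabel_neg_of_mem_frontier lab hv hf)
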